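/- For $n\ge 2$ let $s_i$ ($1\le i\le n-1$) be the transposition of $i$ and $i+1$ in the symmetric group $\mathfrak{S}_n$, and let $w_0=n(n-1)\cdots 21$ (one-line notation) be its longest element. A reduced decomposition of $w_0$ is a word $s_{i_1}s_{i_2}\cdots s_{i_\ell}$ of minimal length whose product is $w_0$. A commutation class of $w_0$ is an equivalence class of reduced decompositions of $w_0$ under the relation generated by the moves $s_is_j\to s_js_i$ on adjacent letters with $|i-j|>1$; $C(w_0)$ is the set of these classes. Put $$\mathcal{O}=\{s_i : 1\le i\le n-1,\ i \text{ odd}\},\qquad \mathcal{E}=\{s_i : 1\le i\le n-1,\ i \text{ even}\}.$$ (a) For every $n\ge 2$ there is a commutation class $C\in C(w_0)$ such that all elements of $C$ have the same leftmost letter, all elements of $C$ have the same rightmost letter, and either every element of $C$ contains exactly one copy of $s_1$ or every element of $C$ contains exactly one copy of $s_{n-1}$ (or both). (b) For every $n\ge 3$ there is a commutation class $C'\in C(w_0)$ with the following property. Let $\mathcal{L}$ be the set of letters that are the leftmost letter of some element of $C'$, and $\mathcal{R}$ the set of letters that are the rightmost letter of some element of $C'$. If $n$ is even, then $\{\mathcal{L},\mathcal{R}\}=\{\mathcal{O},\mathcal{E}\}$.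 If $n$ is odd, then either $\mathcal{L}=\mathcal{R}=\mathcal{O}$ or $\mathcal{L}=\mathcal{R}=\mathcal{E}$; in the first case every element of $C'$ contains exactly one copy of $s_{n-1}$, and in the second case every element of $C'$ contains exactly one copy of $s_1$. -/

import Mathlib

namespace CommutationClasses

/-- The index set `{1, …, n - 1}` of the simple reflections `s_1, …, s_{n-1}` of the symmetric
group on `n` points. -/
abbrev Letter (n : ℕ) : Type := {i : ℕ // 1 ≤ i ∧ i < n}

/-- The symmetric group on `[n] = {1, …, n}`; the point `i` of `[n]` is the element `i - 1` of
`Fin n`. Multiplication is composition of functions. -/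
abbrev Sym (n : ℕ) : Type := Equiv.Perm (Fin n)

/-- The simple reflection `s_i`, transposing `i` and `i + 1`. -/
def simpleReflection {n : ℕ} (i : Letter n) : Sym n :=
  Equiv.swap ⟨i.1 - 1, lt_of_le_of_lt (Nat.sub_le _ _) i.2.2⟩ ⟨i.1, i.2.2⟩

/-- A word `s_{i_1} s_{i_2} ⋯ s_{i_k}`, read from left to right. -/
abbrev Word (n : ℕ) : Type := List (Letter n)

/-- The permutation that a word represents. -/
def wordProd {n : ℕ} (u : Word n) : Sym n := (u.map simpleReflection).prod

/-- `R(w)`: the words of minimal length among those that represent `w`. -/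
def reducedDecompositions {n : ℕ} (w : Sym n) : Set (Word n) :=
  {u | wordProd u = w ∧ ∀ v : Word n, wordProd v = w → u.length ≤ v.length}

/-- A commutation move: two adjacent letters `s_i s_j` with `|i - j| > 1` are exchanged. -/
def CommutationMove {n : ℕ} (u v : Word n) : Prop :=
  ∃ (a b : Word n) (i j : Letter n), (i.1 + 1 < j.1 ∨ j.1 + 1 < i.1) ∧
    u = a ++ i :: j :: b ∧ v = a ++ j :: i :: b

/-- The relation `∼` on `R(w)`: equality up to a sequence of commutation moves. (A commutation
move applied to an element of `R(w)` gives an element of `R(w)`.) -/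
def commutationSetoid {n : ℕ} (w : Sym n) : Setoid (reducedDecompositions w) :=
  (Relation.EqvGen.setoid (CommutationMove (n := n))).comap Subtype.val

/-- `C(w) = R(w) / ∼`. -/
def CommutationClass {n : ℕ} (w : Sym n) : Type := Quotient (commutationSetoid w)

/-- The reduced decompositions that belong to a commutation class. -/
def CommutationClass.elements {n : ℕ} {w : Sym n} (C : CommutationClass w) : Set (Word n) :=
  {u | ∃ h : u ∈ reducedDecompositions w,
    (Quotient.mk (commutationSetoid w) ⟨u, h⟩ : CommutationClass w) = C}

/-- The letters that occur as the leftmost letter of some element of the class. -/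
def CommutationClass.leftmostLetters {n : ℕ} {w : Sym n} (C : CommutationClass w) :
    Set (Letter n) :=
  {i | ∃ u ∈ C.elements, u.head? = some i}

/-- The letters that occur as the rightmost letter of some element of the class. -/
def CommutationClass.rightmostLetters {n : ℕ} {w : Sym n} (C : CommutationClass w) :
    Set (Letter n) :=
  {i | ∃ u ∈ C.elements, u.getLast? = some i}

/-- The number of copies of `s_k` in a word. -/
def copies {n : ℕ} (k : ℕ) (u : Word n) : ℕ := (u.map Subtype.val).count k

/-- The permutation `n (n-1) ⋯ 2 1`, the longest element of the symmetric group. -/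
def longestElement (n : ℕ) : Sym n := Fin.revPerm

/-- `𝒪 = {s_1, s_3, s_5, …} ∩ {s_1, …, s_{n-1}}`. -/
def oddLetters (n : ℕ) : Set (Letter n) := {i | Odd i.1}

/-- `ℰ = {s_2, s_4, s_6, …} ∩ {s_1, …, s_{n-1}}`. -/
def evenLetters (n : ℕ) : Set (Letter n) := {i | Even i.1}

end CommutationClasses

namespace CommutationClasses

/-! Each class is given by an explicit word. Its product is computed pointwise in `natProd`, and
length `n (n - 1) / 2` makes it reduced because one letter creates at most one inversion
(`le_length_of_wordProd_eq`).

The end letters are controlled by an invariant: for neighbouring letters `k`, `m`, commutation moves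
preserve the subword on `{k, m}` (`CommEquiv.filter_eq`). So if `k` occurs before every `m` in one
word of a class, no word of the class starts with `m` (`CommEquiv.head_ne`). Right ends follow by
reversal.

For (a), in `1, 21, 321, …` each `k + 1` is preceded by a `k`, and the same holds in the reversed
word; so both ends are forced to be `1`.

For (b), write `O` and `E` for the odd and even layers on `2(q + 1)` points. If `n = 2(q + 1)`, take
`(O E)^(q + 1)`. If `n = 2q + 3`, follow that word by the cycle `s_{n-1} ⋯ s_1`. Since `E s_{n-1} ⋯
s_1 = s_{n-1} ⋯ s_2 O`, this rewrites to `(O E)^q O · s_{n-1} ⋯ s_2 · O`, which begins and ends with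
`O` and contains `s_{n-1}` once. -/

/-- The permutation of `ℕ` given by a word in the transpositions `(k - 1, k)`. -/
def natProd (l : List ℕ) : Equiv.Perm ℕ := (l.map fun k => Equiv.swap (k - 1) k).prod

lemma natProd_nil (x : ℕ) : natProd [] x = x := rfl

lemma natProd_cons (k : ℕ) (l : List ℕ) (x : ℕ) :
    natProd (k :: l) x = if natProd l x = k - 1 then k
      else if natProd l x = k then k - 1 else natProd l x := by
  simp only [natProd, List.map_cons, List.prod_cons, Equiv.Perm.mul_apply, Equiv.swap_apply_def]
  rfl

lemma natProd_append (l l' : List ℕ) (x : ℕ) :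
    natProd (l ++ l') x = natProd l (natProd l' x) := by
  simp [natProd]

lemma wordProd_cons {n : ℕ} (i : Letter n) (u : Word n) :
    wordProd (i :: u) = simpleReflection i * wordProd u := by
  simp [wordProd]

lemma wordProd_append {n : ℕ} (u v : Word n) :
    wordProd (u ++ v) = wordProd u * wordProd v := by
  simp [wordProd]

/-- Moving to `ℕ` frees products from `n`, so that they become case distinctions in linear
arithmetic. -/
lemma wordProd_apply_val {n : ℕ} (u : Word n) (x : Fin n) :
    (wordProd u x).val = natProd (u.map Subtype.val) x.val := by
  induction u with
  | nil => rfl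
  | cons i u ih =>
    rw [wordProd_cons, List.map_cons, natProd_cons, ← ih, Equiv.Perm.mul_apply, simpleReflection,
      Equiv.swap_apply_def]
    simp only [Fin.ext_iff]
    split_ifs <;> rfl

/-! ### Inversions and the lower bound on length -/

/-- The inversions of a permutation. -/
def inversions {n : ℕ} (w : Sym n) : Finset (Fin n × Fin n) :=
  Finset.univ.filter fun q => q.1 < q.2 ∧ w q.2 < w q.1

lemma mem_inversions {n : ℕ} {w : Sym n} {a b : Fin n} :
    (a, b) ∈ inversions w ↔ a < b ∧ w b < w a := by
  simp [inversions]

/-- Exchanging two consecutive values changes the relative order of only the two positions that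
carry them. -/
lemma card_inversions_simpleReflection_mul_le {n : ℕ} (i : Letter n) (w : Sym n) :
    (inversions (simpleReflection i * w)).card ≤ (inversions w).card + 1 := by
  refine le_trans (Finset.card_le_card (t := insert
    (w.symm ⟨i.1 - 1, lt_of_le_of_lt (Nat.sub_le _ _) i.2.2⟩, w.symm ⟨i.1, i.2.2⟩)
      (inversions w)) ?_) (Finset.card_insert_le _ _)
  rintro ⟨a, b⟩ h
  rw [mem_inversions] at h
  rw [Finset.mem_insert, mem_inversions]
  simp only [Equiv.Perm.mul_apply, simpleReflection, Equiv.swap_apply_def, Prod.mk.injEq,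
    Equiv.eq_symm_apply] at h ⊢
  obtain ⟨hab, h⟩ := h
  have hne : w a ≠ w b := fun e => hab.ne (w.injective e)
  have hi := i.2.1
  simp only [Fin.ext_iff, Fin.lt_def, ne_eq] at *
  split_ifs at h <;> (try simp only at h) <;> omega

lemma card_inversions_wordProd_le {n : ℕ} (u : Word n) :
    (inversions (wordProd u)).card ≤ u.length := by
  induction u with
  | nil =>
    simp only [inversions, wordProd, List.map_nil, List.prod_nil, Equiv.Perm.one_apply,
      List.length_nil, Nat.le_zero, Finset.card_eq_zero, Finset.filter_eq_empty_iff]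
    intro q _ h
    exact lt_asymm h.1 h.2
  | cons i u ih =>
    rw [wordProd_cons, List.length_cons]
    exact (card_inversions_simpleReflection_mul_le i _).trans (Nat.succ_le_succ ih)

lemma card_inversions_longestElement (n : ℕ) :
    2 * (inversions (longestElement n)).card = n * (n - 1) := by
  have h : inversions (longestElement n) =
      (Finset.univ : Finset (Fin n)).biUnion fun b => (Finset.Iio b).image fun a => (a, b) := by
    ext ⟨a, b⟩
    simp [inversions, longestElement]
  have hc : (inversions (longestElement n)).card = ∑ b : Fin n, b.val := by
    rw [h, Finset.card_biUnion]
    · refine Finset.sum_congr rfl fun b _ => ?_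
      rw [Finset.card_image_of_injective _ (fun x y e => (Prod.mk.inj e).1), Fin.card_Iio]
    · intro b _ c _ hbc
      rw [Function.onFun, Finset.disjoint_left]
      simp only [Finset.mem_image]
      rintro _ ⟨x, _, rfl⟩ ⟨y, _, e⟩
      exact hbc (Prod.mk.inj e).2.symm
  rw [hc, Fin.sum_univ_eq_sum_range fun b => b, mul_comm, Finset.sum_range_id_mul_two]

lemma le_length_of_wordProd_eq {n : ℕ} {u : Word n} (h : wordProd u = longestElement n) :
    n * (n - 1) ≤ 2 * u.length := by
  rw [← card_inversions_longestElement, ← h]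
  exact Nat.mul_le_mul_left 2 (card_inversions_wordProd_le u)

/-! ### Invariants of commutation classes and their end letters -/

/-- Equality of words up to commutation moves. -/
abbrev CommEquiv {n : ℕ} : Word n → Word n → Prop := Relation.EqvGen CommutationMove

lemma simpleReflection_comm {n : ℕ} {i j : Letter n} (h : i.1 + 1 < j.1 ∨ j.1 + 1 < i.1) :
    simpleReflection i * simpleReflection j = simpleReflection j * simpleReflection i := by
  have hi := i.2.1
  have hj := j.2.1
  apply Equiv.Perm.Disjoint.commute
  intro x
  simp only [simpleReflection, Equiv.swap_apply_def, Fin.ext_iff]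
  split_ifs <;> simp <;> omega

lemma CommEquiv.wordProd_eq {n : ℕ} {u v : Word n} (h : CommEquiv u v) :
    wordProd u = wordProd v := by
  induction h with
  | rel u v h =>
    obtain ⟨a, b, i, j, hij, rfl, rfl⟩ := h
    simp only [wordProd_append, wordProd_cons]
    rw [← mul_assoc (simpleReflection i), simpleReflection_comm hij, mul_assoc]
  | refl => rfl
  | symm _ _ _ ih => exact ih.symm
  | trans _ _ _ _ _ h₁ h₂ => exact h₁.trans h₂

lemma CommEquiv.perm {n : ℕ} {u v : Word n} (h : CommEquiv u v) : u.Perm v := by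
  induction h with
  | rel u v h =>
    obtain ⟨a, b, i, j, hij, rfl, rfl⟩ := h
    exact (List.Perm.swap j i b).append_left a
  | refl => rfl
  | symm _ _ _ ih => exact ih.symm
  | trans _ _ _ _ _ h₁ h₂ => exact h₁.trans h₂

lemma CommEquiv.copies_eq {n : ℕ} {u v : Word n} (h : CommEquiv u v) (k : ℕ) :
    copies k u = copies k v :=
  (h.perm.map _).count_eq k

lemma CommEquiv.reverse {n : ℕ} {u v : Word n} (h : CommEquiv u v) :
    CommEquiv u.reverse v.reverse := by
  induction h with
  | rel u v h =>
    obtain ⟨a, b, i, j, hij, rfl, rfl⟩ := h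
    exact .rel _ _ ⟨b.reverse, a.reverse, j, i, hij.symm, by simp, by simp⟩
  | refl => exact .refl _
  | symm _ _ _ ih => exact ih.symm
  | trans _ _ _ _ _ h₁ h₂ => exact h₁.trans _ _ _ h₂

lemma CommEquiv.cons {n : ℕ} {u v : Word n} (h : CommEquiv u v) (i : Letter n) :
    CommEquiv (i :: u) (i :: v) := by
  induction h with
  | rel u v h =>
    obtain ⟨a, b, j, k, hjk, rfl, rfl⟩ := h
    exact .rel _ _ ⟨i :: a, b, j, k, hjk, rfl, rfl⟩
  | refl => exact .refl _
  | symm _ _ _ ih => exact ih.symm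
  | trans _ _ _ _ _ h₁ h₂ => exact h₁.trans _ _ _ h₂

/-- The subword on two neighbouring letters is an invariant of the commutation class. -/
lemma CommEquiv.filter_eq {n : ℕ} {u v : Word n} (h : CommEquiv u v) {k m : ℕ}
    (hkm : m = k + 1 ∨ k = m + 1) :
    u.filter (fun i => i.1 = k ∨ i.1 = m) = v.filter (fun i => i.1 = k ∨ i.1 = m) := by
  induction h with
  | rel u v h =>
    obtain ⟨a, b, i, j, hij, rfl, rfl⟩ := h
    simp only [List.filter_append, List.filter_cons, decide_eq_true_eq]
    -- The exchanged letters differ by more than 1, so at most one of them survives the filter.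
    split_ifs <;> first | rfl | omega
  | refl => rfl
  | symm _ _ _ ih => exact ih.symm
  | trans _ _ _ _ _ h₁ h₂ => exact h₁.trans h₂

/-- A letter that is preceded by a neighbour is not a leftmost letter of the class. -/
lemma CommEquiv.head_ne {n : ℕ} {u v : Word n} (h : CommEquiv u v) {k m : ℕ}
    (hkm : m = k + 1 ∨ k = m + 1) {a b : List ℕ} (hu : u.map Subtype.val = a ++ b)
    (hk : k ∈ a) (hm : m ∉ a) {i : Letter n} (hi : v.head? = some i) : i.1 ≠ m := by
  rintro rfl
  obtain ⟨v, rfl⟩ : ∃ w, v = i :: w := by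
    cases v with
    | nil => simp at hi
    | cons j w => exact ⟨w, by simpa using hi⟩
  obtain ⟨a', b', rfl, rfl, rfl⟩ := List.map_eq_append_iff.1 hu
  have hf := h.filter_eq hkm
  rw [List.filter_append, List.filter_cons_of_pos (by simp)] at hf
  -- The filtered prefix is nonempty, so its first letter equals the first letter `i` of `v`; but
  -- `i` does not occur in the prefix.
  cases hc : a'.filter (fun j => j.1 = k ∨ j.1 = i.1) with
  | nil =>
    obtain ⟨j, hj, rfl⟩ := List.mem_map.1 hk
    have := List.filter_eq_nil_iff.1 hc j hj
    simp at this
  | cons j w =>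
    rw [hc, List.cons_append] at hf
    have hj : j ∈ a' := (List.mem_filter.1 (hc ▸ List.mem_cons_self)).1
    rw [(List.cons.inj hf).1] at hj
    exact hm (List.mem_map_of_mem hj)

lemma commEquiv_move_to_front {n : ℕ} (a b : Word n) (i : Letter n)
    (h : ∀ j ∈ a, i.1 + 1 < j.1 ∨ j.1 + 1 < i.1) : CommEquiv (a ++ i :: b) (i :: (a ++ b)) := by
  induction a with
  | nil => exact .refl _
  | cons j a ih =>
    refine .trans _ _ _ ((ih fun k hk => h k (List.mem_cons_of_mem _ hk)).cons j) (.rel _ _ ?_)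
    exact ⟨[], a ++ b, j, i, (h j List.mem_cons_self).symm, rfl, rfl⟩

/-- If a word starts with all the letters of one parity, then these are the leftmost letters of
its class. -/
lemma setOf_head_eq {n : ℕ} (hn : 3 ≤ n) {u : Word n} {a b : List ℕ} {r : ℕ}
    (hu : u.map Subtype.val = a ++ b) (hr : r < 2)
    (ha : ∀ k, k ∈ a ↔ 1 ≤ k ∧ k < n ∧ k % 2 = r) :
    {i : Letter n | ∃ v, CommEquiv u v ∧ v.head? = some i} = {i | i.1 % 2 = r} := by
  ext i
  simp only [Set.mem_ofPred_eq]
  have hi := i.2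
  constructor
  · rintro ⟨v, hv, hvi⟩
    by_contra hir
    have hm : i.1 ∉ a := fun h => hir ((ha _).1 h).2.2
    -- A letter of the wrong parity has a neighbour in `a`: the one below it, except that for `1` it
    -- is `2`, a letter because `3 ≤ n`.
    by_cases h1 : i.1 = 1
    · exact hv.head_ne (k := 2) (m := 1) (by omega) hu ((ha _).2 (by omega)) (h1 ▸ hm) hvi h1
    · exact hv.head_ne (k := i.1 - 1) (m := i.1) (by omega) hu ((ha _).2 (by omega)) hm hvi rfl
  · intro hir
    obtain ⟨a', b', rfl, rfl, rfl⟩ := List.map_eq_append_iff.1 hu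
    have hia : i ∈ a' := by
      obtain ⟨j, hj, hji⟩ := List.mem_map.1 ((ha i.1).2 ⟨hi.1, hi.2, hir⟩)
      rwa [← Subtype.ext hji]
    obtain ⟨c, d, rfl, hc⟩ := List.eq_append_cons_of_mem hia
    refine ⟨i :: (c ++ (d ++ b')), ?_, rfl⟩
    rw [List.append_assoc, List.cons_append]
    -- Distinct letters of equal parity differ by at least 2, so `i` passes everything in `c`.
    refine commEquiv_move_to_front _ _ _ fun j hj => ?_
    have hjr := ((ha j.1).1 (List.mem_map_of_mem (List.mem_append_left _ hj))).2.2
    have hne : j.1 ≠ i.1 := fun e => hc (Subtype.ext e ▸ hj)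
    omega

lemma head_reverse_iff {n : ℕ} (u : Word n) (i : Letter n) :
    (∃ v, CommEquiv u v ∧ v.getLast? = some i) ↔
      ∃ v, CommEquiv u.reverse v ∧ v.head? = some i := by
  constructor
  · rintro ⟨v, hv, hi⟩
    exact ⟨v.reverse, hv.reverse, by rwa [List.head?_reverse]⟩
  · rintro ⟨v, hv, hi⟩
    exact ⟨v.reverse, by simpa using hv.reverse, by rwa [List.getLast?_reverse]⟩

lemma setOf_getLast_eq {n : ℕ} (hn : 3 ≤ n) {u : Word n} {a b : List ℕ} {r : ℕ}
    (hu : u.map Subtype.val = b ++ a) (hr : r < 2)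
    (ha : ∀ k, k ∈ a ↔ 1 ≤ k ∧ k < n ∧ k % 2 = r) :
    {i : Letter n | ∃ v, CommEquiv u v ∧ v.getLast? = some i} = {i | i.1 % 2 = r} := by
  simp only [head_reverse_iff]
  refine setOf_head_eq hn (hr := hr) (a := a.reverse) (b := b.reverse) ?_ (by simpa using ha)
  rw [List.map_reverse, hu, List.reverse_append]

/-- A word of length `n (n - 1) / 2` for the longest element gives a commutation class. -/
lemma exists_commutationClass {n : ℕ} {l : List ℕ} (hl : ∀ k ∈ l, 1 ≤ k ∧ k < n)
    (hlen : 2 * l.length = n * (n - 1)) (hprod : ∀ x < n, natProd l x = n - 1 - x) :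
    ∃ (C : CommutationClass (longestElement n)) (u : Word n), u.map Subtype.val = l ∧
      ∀ v, v ∈ C.elements ↔ CommEquiv u v := by
  lift l to List (Letter n) using hl with u
  have hu : wordProd u = longestElement n := by
    ext x
    rw [wordProd_apply_val, hprod _ x.2, longestElement, Fin.revPerm_apply, Fin.val_rev]
    omega
  have hmem : ∀ v, CommEquiv u v → v ∈ reducedDecompositions (longestElement n) := by
    intro v hv
    refine ⟨hv.wordProd_eq ▸ hu, fun w hw => ?_⟩
    have := le_length_of_wordProd_eq hw
    have := hv.perm.length_eq
    rw [List.length_map] at hlen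
    omega
  refine ⟨Quotient.mk _ ⟨u, hmem u (.refl _)⟩, u, rfl, fun v => ⟨?_, fun hv => ?_⟩⟩
  · rintro ⟨hv, e⟩
    exact (Quotient.exact e).symm
  · exact ⟨hmem v hv, Quotient.sound (.symm _ _ hv)⟩

/-! ### The staircase word and part (a) -/

/-- The word `a + m, …, a + 2, a + 1`. -/
def descending (a : ℕ) : ℕ → List ℕ
  | 0 => []
  | m + 1 => (a + m + 1) :: descending a m

lemma mem_descending {a m k : ℕ} : k ∈ descending a m ↔ a < k ∧ k ≤ a + m := by
  induction m with
  | zero => simp [descending]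
  | succ m ih => rw [descending, List.mem_cons, ih]; omega

lemma length_descending (a m : ℕ) : (descending a m).length = m := by
  induction m with
  | zero => rfl
  | succ m ih => rw [descending, List.length_cons, ih]

lemma count_descending (a m : ℕ) : (descending a (m + 1)).count (a + m + 1) = 1 := by
  rw [descending, List.count_cons_self, List.count_eq_zero_of_not_mem]
  rw [mem_descending]
  omega

lemma natProd_descending (a m x : ℕ) : natProd (descending a m) x =
    if x = a then a + m else if a < x ∧ x ≤ a + m then x - 1 else x := by
  induction m with
  | zero => rw [descending, natProd_nil]; split_ifs <;> omega
  | succ m ih => rw [descending, natProd_cons, ih]; split_ifs <;> omega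

/-- The word `1, 2 1, 3 2 1, …, (n - 1) ⋯ 2 1`. -/
def staircase : ℕ → List ℕ
  | 0 => []
  | m + 1 => staircase m ++ descending 0 m

lemma mem_staircase {m k : ℕ} : k ∈ staircase m ↔ 1 ≤ k ∧ k < m := by
  induction m with
  | zero => simp [staircase]
  | succ m ih => rw [staircase, List.mem_append, ih, mem_descending]; omega

lemma length_staircase (m : ℕ) : 2 * (staircase m).length = m * (m - 1) := by
  induction m with
  | zero => rfl
  | succ m ih =>
    rw [staircase, List.length_append, length_descending, mul_add, ih]
    cases m with
    | zero => rfl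
    | succ m => simp only [Nat.add_sub_cancel]; ring

/-- The last block sends `0` to the top and lowers the other points by one; the shorter staircase
then reverses these. -/
lemma natProd_staircase (m x : ℕ) :
    natProd (staircase m) x = if x < m then m - 1 - x else x := by
  induction m generalizing x with
  | zero => simp [staircase, natProd_nil]
  | succ m ih =>
    rw [staircase, natProd_append, ih, natProd_descending]; split_ifs <;> omega

lemma staircase_prefix {k m : ℕ} (h : k ≤ m) : ∃ b, staircase m = staircase k ++ b := by
  induction m, h using Nat.le_induction with
  | base => exact ⟨[], by simp⟩
  | succ m _ ih =>
    obtain ⟨b, hb⟩ := ih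
    exact ⟨b ++ descending 0 m, by rw [staircase, hb, List.append_assoc]⟩

lemma descending_suffix (a : ℕ) {k m : ℕ} (h : k ≤ m) :
    ∃ b, descending a m = b ++ descending a k := by
  induction m, h using Nat.le_induction with
  | base => exact ⟨[], rfl⟩
  | succ m _ ih =>
    obtain ⟨b, hb⟩ := ih
    exact ⟨(a + m + 1) :: b, by rw [descending, hb, List.cons_append]⟩

lemma exists_class_unique_ends (n : ℕ) (hn : 2 ≤ n) :
    ∃ C : CommutationClass (longestElement n),
      (∃ i : Letter n, ∀ u ∈ C.elements, u.head? = some i) ∧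
      (∃ j : Letter n, ∀ u ∈ C.elements, u.getLast? = some j) ∧
      ∀ u ∈ C.elements, copies (n - 1) u = 1 := by
  obtain ⟨C, u, hu, hC⟩ := exists_commutationClass (l := staircase n)
    (fun k hk => mem_staircase.1 hk) (length_staircase n)
    (fun x hx => by rw [natProd_staircase, if_pos hx])
  obtain ⟨m, rfl⟩ : ∃ m, n = m + 2 := ⟨n - 2, by omega⟩
  have hcount : copies (m + 1) u = 1 := by
    have h := count_descending 0 m
    rw [Nat.zero_add] at h
    rw [copies, hu, staircase, List.count_append, List.count_eq_zero_of_not_mem, h]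
    rw [mem_staircase]
    omega
  have hne : u ≠ [] := by
    rintro rfl
    simp [copies] at hcount
  -- Stated for any word `w` so that it serves both `u` and its reverse.
  have key : ∀ w : Word (m + 2), w ≠ [] →
      (∀ k, 1 ≤ k → k < m + 1 → ∃ a b, w.map Subtype.val = a ++ b ∧ k ∈ a ∧ k + 1 ∉ a) →
      ∀ v, CommEquiv w v → v.head? = some ⟨1, le_rfl, by omega⟩ := by
    intro w hw hk v hv
    cases v with
    | nil => exact absurd hv.perm.eq_nil hw
    | cons i v =>
      rw [List.head?_cons, Option.some_inj, Subtype.ext_iff]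
      by_contra h1
      have hi := i.2
      simp only at h1
      obtain ⟨a, b, hab, ha, ha'⟩ := hk (i.1 - 1) (by omega) (by omega)
      exact hv.head_ne (.inl rfl) hab ha ha' (List.head?_cons) (by omega)
  refine ⟨C, ⟨⟨1, le_rfl, by omega⟩, fun v hv => ?_⟩, ⟨⟨1, le_rfl, by omega⟩, fun v hv => ?_⟩,
    fun v hv => ?_⟩
  · refine key u hne (fun k h1 hk => ?_) v ((hC v).1 hv)
    obtain ⟨b, hb⟩ := staircase_prefix (k := k + 1) (m := m + 2) (by omega)
    exact ⟨_, b, hu.trans hb, mem_staircase.2 (by omega), fun h => by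
      have := mem_staircase.1 h; omega⟩
  · rw [← List.head?_reverse]
    refine key u.reverse (by simpa using hne) (fun k h1 hk => ?_) _ ((hC v).1 hv).reverse
    obtain ⟨b, hb⟩ := descending_suffix 0 (k := k) (m := m + 1) (by omega)
    refine ⟨(descending 0 k).reverse, (staircase (m + 1) ++ b).reverse, ?_, ?_, ?_⟩
    · rw [List.map_reverse, hu, staircase, hb, ← List.reverse_append, List.append_assoc]
    · rw [List.mem_reverse, mem_descending]; omega
    · rw [List.mem_reverse, mem_descending]; omega
  · rw [← ((hC v).1 hv).copies_eq]
    exact hcount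

/-! ### Alternating layers and part (b) -/

/-- The word `1, 3, …, 2 p - 1`. -/
def oddLayer (p : ℕ) : List ℕ := (List.range p).map fun j => 2 * j + 1

/-- The word `2, 4, …, 2 q`. -/
def evenLayer (q : ℕ) : List ℕ := (List.range q).map fun j => 2 * j + 2

lemma mem_oddLayer {p k : ℕ} : k ∈ oddLayer p ↔ k < 2 * p ∧ k % 2 = 1 := by
  simp only [oddLayer, List.mem_map, List.mem_range]
  exact ⟨by rintro ⟨j, h, rfl⟩; omega, fun h => ⟨k / 2, by omega, by omega⟩⟩

lemma mem_evenLayer {q k : ℕ} : k ∈ evenLayer q ↔ 1 ≤ k ∧ k ≤ 2 * q ∧ k % 2 = 0 := by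
  simp only [evenLayer, List.mem_map, List.mem_range]
  exact ⟨by rintro ⟨j, h, rfl⟩; omega, fun h => ⟨k / 2 - 1, by omega, by omega⟩⟩

lemma natProd_oddLayer (p x : ℕ) : natProd (oddLayer p) x =
    if x < 2 * p then if x % 2 = 0 then x + 1 else x - 1 else x := by
  induction p generalizing x with
  | zero => simp [oddLayer, natProd_nil]
  | succ p ih =>
    have h : oddLayer (p + 1) = oddLayer p ++ [2 * p + 1] := by simp [oddLayer, List.range_succ]
    rw [h, natProd_append, ih, natProd_cons, natProd_nil]
    split_ifs <;> omega

lemma natProd_evenLayer (q x : ℕ) : natProd (evenLayer q) x =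
    if 1 ≤ x ∧ x ≤ 2 * q then if x % 2 = 0 then x - 1 else x + 1 else x := by
  induction q generalizing x with
  | zero =>
    simp only [evenLayer, List.range_zero, List.map_nil, natProd_nil]
    split_ifs <;> omega
  | succ q ih =>
    have h : evenLayer (q + 1) = evenLayer q ++ [2 * q + 2] := by
      simp [evenLayer, List.range_succ]
    rw [h, natProd_append, ih, natProd_cons, natProd_nil]
    split_ifs <;> omega

/-- `k` rounds of alternating odd and even layers on `2 (q + 1)` points. -/
def brick (q : ℕ) : ℕ → List ℕ
  | 0 => []
  | k + 1 => brick q k ++ (oddLayer (q + 1) ++ evenLayer q)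

lemma brick_succ' (q k : ℕ) :
    brick q (k + 1) = (oddLayer (q + 1) ++ evenLayer q) ++ brick q k := by
  induction k with
  | zero => simp [brick]
  | succ k ih => rw [brick, ih, List.append_assoc, ← brick, ih]

lemma mem_brick {q k x : ℕ} (h : x ∈ brick q k) : 1 ≤ x ∧ x < 2 * (q + 1) := by
  induction k with
  | zero => simp [brick] at h
  | succ k ih =>
    rw [brick, List.mem_append, List.mem_append, mem_oddLayer, mem_evenLayer] at h
    rcases h with h | h
    · exact ih h
    · omega

lemma length_brick (q k : ℕ) : (brick q k).length = k * (2 * q + 1) := by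
  induction k with
  | zero => simp [brick]
  | succ k ih =>
    simp only [brick, List.length_append, ih, oddLayer, evenLayer, List.length_map,
      List.length_range]
    ring

/-- Each round moves even points down by 2 and odd points up by 2, with a reflection and change of
parity at the ends. The bound on `k` ensures that a point is reflected at most once. -/
lemma natProd_brick {q k : ℕ} (hk : k ≤ q + 1) (x : ℕ) : natProd (brick q k) x =
    if x < 2 * (q + 1) then
      if x % 2 = 0 then if 2 * k ≤ x then x - 2 * k else 2 * k - 1 - x
      else if x + 2 * k < 2 * (q + 1) then x + 2 * k else 4 * (q + 1) - 1 - (x + 2 * k)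
    else x := by
  induction k generalizing x with
  | zero =>
    rw [brick, natProd_nil]
    split_ifs <;> omega
  | succ k ih =>
    rw [brick_succ', natProd_append, ih (by omega), natProd_append, natProd_oddLayer,
      natProd_evenLayer]
    split_ifs <;> omega

/-- This is the reversal of `2 * q + 2` points with the final even layer removed. -/
lemma natProd_brick_append_oddLayer (q x : ℕ) :
    natProd (brick q q ++ oddLayer (q + 1)) x =
      if x = 0 then 2 * q + 1 else if x = 2 * q + 1 then 0
      else if x < 2 * q + 1 then if x % 2 = 0 then 2 * q + 2 - x else 2 * q - x else x := by
  rw [natProd_append, natProd_oddLayer, natProd_brick (Nat.le_succ q)]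
  by_cases hx : x < 2 * (q + 1)
  · rw [if_pos hx]
    by_cases hx2 : x % 2 = 0
    · rw [if_pos hx2, if_pos (by omega), if_neg (by omega)]
      split_ifs <;> omega
    · rw [if_neg hx2, if_pos (by omega), if_pos (by omega)]
      split_ifs <;> omega
  · rw [if_neg hx, if_neg hx]
    split_ifs <;> omega

lemma natProd_descending_append_oddLayer (q x : ℕ) :
    natProd (descending 1 (2 * q + 1) ++ oddLayer (q + 1)) x =
      if x = 0 then 2 * q + 2 else if x = 1 then 0 else if x = 2 * q + 2 then 2 * q + 1
      else if x < 2 * q + 2 then if x % 2 = 0 then x else x - 2 else x := by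
  rw [natProd_append, natProd_oddLayer, natProd_descending]
  split_ifs <;> omega

lemma leftmostLetters_eq {n : ℕ} {C : CommutationClass (longestElement n)} {u : Word n}
    (hC : ∀ v, v ∈ C.elements ↔ CommEquiv u v) :
    C.leftmostLetters = {i | ∃ v, CommEquiv u v ∧ v.head? = some i} := by
  simp only [CommutationClass.leftmostLetters, hC]

lemma rightmostLetters_eq {n : ℕ} {C : CommutationClass (longestElement n)} {u : Word n}
    (hC : ∀ v, v ∈ C.elements ↔ CommEquiv u v) :
    C.rightmostLetters = {i | ∃ v, CommEquiv u v ∧ v.getLast? = some i} := by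
  simp only [CommutationClass.rightmostLetters, hC]

lemma oddLetters_eq (n : ℕ) : oddLetters n = {i | i.1 % 2 = 1} := by
  simp only [oddLetters, Nat.odd_iff]

lemma evenLetters_eq (n : ℕ) : evenLetters n = {i | i.1 % 2 = 0} := by
  simp only [evenLetters, Nat.even_iff]

lemma exists_class_even (q : ℕ) (hq : 1 ≤ q) :
    ∃ C : CommutationClass (longestElement (2 * (q + 1))),
      C.leftmostLetters = oddLetters _ ∧ C.rightmostLetters = evenLetters _ := by
  obtain ⟨C, u, hu, hC⟩ := exists_commutationClass (n := 2 * (q + 1)) (l := brick q (q + 1))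
    (fun k hk => mem_brick hk)
    (by rw [length_brick, show 2 * (q + 1) - 1 = 2 * q + 1 by omega, mul_assoc])
    (fun x hx => by rw [natProd_brick le_rfl]; split_ifs <;> omega)
  refine ⟨C, ?_, ?_⟩
  · rw [leftmostLetters_eq hC, oddLetters_eq]
    refine setOf_head_eq (by omega) (hr := by omega) (a := oddLayer (q + 1))
      (b := evenLayer q ++ brick q q) ?_ ?_
    · rw [hu, brick_succ', List.append_assoc]
    · intro k; rw [mem_oddLayer]; omega
  · rw [rightmostLetters_eq hC, evenLetters_eq]
    refine setOf_getLast_eq (by omega) (hr := by omega) (a := evenLayer q)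
      (b := brick q q ++ oddLayer (q + 1)) ?_ ?_
    · rw [hu, brick, List.append_assoc]
    · intro k; rw [mem_evenLayer]; omega

lemma exists_class_odd (q : ℕ) :
    ∃ C : CommutationClass (longestElement (2 * (q + 1) + 1)),
      C.leftmostLetters = oddLetters _ ∧ C.rightmostLetters = oddLetters _ ∧
      ∀ u ∈ C.elements, copies (2 * (q + 1)) u = 1 := by
  -- The last even layer of the brick word has been carried through the cycle `s_{n-1} ⋯ s_1`: its
  -- letters rise by one to `3, 5, …`, and join the final `1` of the cycle in an odd layer.
  obtain ⟨C, u, hu, hC⟩ := exists_commutationClass (n := 2 * (q + 1) + 1)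
    (l := (brick q q ++ oddLayer (q + 1)) ++ (descending 1 (2 * q + 1) ++ oddLayer (q + 1)))
    (fun k hk => by
      simp only [List.mem_append, mem_descending, mem_oddLayer] at hk
      rcases hk with (hk | hk) | hk
      · have := mem_brick hk; omega
      all_goals omega)
    (by
      simp only [List.length_append, length_brick, length_descending, oddLayer, List.length_map,
        List.length_range, Nat.add_sub_cancel]
      ring)
    (fun x hx => by
      rw [natProd_append, natProd_brick_append_oddLayer, natProd_descending_append_oddLayer]
      split_ifs <;> first | omega | contradiction)
  refine ⟨C, ?_, ?_, fun v hv => ?_⟩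
  · rw [leftmostLetters_eq hC, oddLetters_eq]
    obtain ⟨b, hb⟩ : ∃ b, brick q q ++ oddLayer (q + 1) = oddLayer (q + 1) ++ b := by
      cases q with
      | zero => exact ⟨[], by simp [brick]⟩
      | succ q => exact ⟨_, by rw [brick_succ', List.append_assoc, List.append_assoc]⟩
    refine setOf_head_eq (by omega) (hr := by omega) (a := oddLayer (q + 1))
      (b := b ++ (descending 1 (2 * q + 1) ++ oddLayer (q + 1))) ?_ ?_
    · rw [hu, hb, List.append_assoc]
    · intro k; rw [mem_oddLayer]; omega
  · rw [rightmostLetters_eq hC, oddLetters_eq]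
    refine setOf_getLast_eq (by omega) (hr := by omega) (a := oddLayer (q + 1))
      (hu.trans (List.append_assoc _ _ _).symm) ?_
    intro k; rw [mem_oddLayer]; omega
  · rw [← ((hC v).1 hv).copies_eq, copies, hu]
    have h1 : 2 * (q + 1) ∉ oddLayer (q + 1) := by rw [mem_oddLayer]; omega
    have h2 : 2 * (q + 1) ∉ brick q q := fun h => by have := mem_brick h; omega
    have h3 := count_descending 1 (2 * q)
    rw [show 1 + 2 * q + 1 = 2 * (q + 1) by ring] at h3
    simp only [List.count_append, List.count_eq_zero_of_not_mem h1,
      List.count_eq_zero_of_not_mem h2, h3]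

lemma oddLetters_ne_evenLetters {n : ℕ} (hn : 2 ≤ n) : oddLetters n ≠ evenLetters n := by
  intro h
  have h1 : (⟨1, le_rfl, hn⟩ : Letter n) ∈ oddLetters n := odd_one
  rw [h] at h1
  exact Nat.not_even_one h1

end CommutationClasses

theorem mainTheorem5 (n : ℕ) (hn : 2 ≤ n) :
    (∃ C : CommutationClasses.CommutationClass (CommutationClasses.longestElement n),
      (∃ i : CommutationClasses.Letter n, ∀ u ∈ C.elements, u.head? = some i) ∧
      (∃ j : CommutationClasses.Letter n, ∀ u ∈ C.elements, u.getLast? = some j) ∧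
      ((∀ u ∈ C.elements, CommutationClasses.copies 1 u = 1) ∨
        (∀ u ∈ C.elements, CommutationClasses.copies (n - 1) u = 1))) ∧
    (3 ≤ n →
      ∃ C' : CommutationClasses.CommutationClass (CommutationClasses.longestElement n),
        (Even n →
          ({C'.leftmostLetters, C'.rightmostLetters} : Set (Set (CommutationClasses.Letter n))) =
            {CommutationClasses.oddLetters n, CommutationClasses.evenLetters n}) ∧
        (Odd n →
          ((C'.leftmostLetters = CommutationClasses.oddLetters n ∧
              C'.rightmostLetters = CommutationClasses.oddLetters n) ∨
            (C'.leftmostLetters = CommutationClasses.evenLetters n ∧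
              C'.rightmostLetters = CommutationClasses.evenLetters n)) ∧
          ((C'.leftmostLetters = CommutationClasses.oddLetters n ∧
              C'.rightmostLetters = CommutationClasses.oddLetters n) →
            ∀ u ∈ C'.elements, CommutationClasses.copies (n - 1) u = 1) ∧
          ((C'.leftmostLetters = CommutationClasses.evenLetters n ∧
              C'.rightmostLetters = CommutationClasses.evenLetters n) →
            ∀ u ∈ C'.elements, CommutationClasses.copies 1 u = 1))) := by
  refine ⟨?_, fun hn3 => ?_⟩
  · obtain ⟨C, hl, hr, hc⟩ := CommutationClasses.exists_class_unique_ends n hn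
    exact ⟨C, hl, hr, .inr hc⟩
  · rcases Nat.even_or_odd' n with ⟨p, rfl | rfl⟩
    · obtain ⟨q, rfl⟩ : ∃ q, p = q + 1 := ⟨p - 1, by omega⟩
      obtain ⟨C, hl, hr⟩ := CommutationClasses.exists_class_even q (by omega)
      refine ⟨C, fun _ => by rw [hl, hr], fun h => ?_⟩
      exact absurd h (Nat.not_odd_iff_even.2 (even_two_mul _))
    · obtain ⟨q, rfl⟩ : ∃ q, p = q + 1 := ⟨p - 1, by omega⟩
      obtain ⟨C, hl, hr, hc⟩ := CommutationClasses.exists_class_odd q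
      refine ⟨C, fun h => ?_, fun _ => ⟨.inl ⟨hl, hr⟩, fun _ => hc, fun h => ?_⟩⟩
      · exact absurd h (Nat.not_even_iff_odd.2 (odd_two_mul_add_one _))
      -- The class has odd ends, so the even alternative is vacuous.
      · exact absurd (hl.symm.trans h.1) (CommutationClasses.oddLetters_ne_evenLetters hn)
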